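/- Let $X$ be a complex manifold (Hausdorff, with countable base of topology, of pure dimension, not necessarily connected) with $\dim_{\mathbb C}(X)>0$. Let $\mathrm{Aut}(X)$ be the group of all biholomorphic maps $X\to X$ with the topology induced by the embedding $\varphi\mapsto(\varphi,\varphi^{-1})$ into $\mathrm{Hol}(X,X)\times\mathrm{Hol}(X,X)$, where $\mathrm{Hol}(X,X)$ carries the compact-open topology. Assume that $\mathrm{Aut}(X)$ with this topology is a (finite-dimensional) real Lie group. Then there exists a discrete subset $D\subset X$ (that is, a closed subset whose subspace topology is discrete) such that every $\varphi\in\mathrm{Aut}(X)$ with $\varphi(D)\subset D$ is the identity map $\mathrm{id}_X$. -/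

import Mathlib

open scoped Manifold ContDiff

/-- The automorphism group of a complex manifold `X` modelled on the complex vector space `E`:
the biholomorphic (complex analytic in both directions) maps from `X` to itself. -/
def HolAut (E : Type*) [NormedAddCommGroup E] [NormedSpace ℂ E]
    (X : Type*) [TopologicalSpace X] [ChartedSpace E X] : Type _ :=
  Diffeomorph 𝓘(ℂ, E) 𝓘(ℂ, E) X X ω

namespace HolAut

variable {E : Type*} [NormedAddCommGroup E] [NormedSpace ℂ E]
  {X : Type*} [TopologicalSpace X] [ChartedSpace E X]

/-- An automorphism, seen as a map `X → X`. -/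
instance : CoeFun (HolAut E X) (fun _ => X → X) := ⟨fun φ => φ.toEquiv⟩

theorem ext {φ ψ : HolAut E X} (h : ∀ x, φ x = ψ x) : φ = ψ :=
  Diffeomorph.ext h

/-- The group law is composition of maps: `(φ * ψ) x = φ (ψ x)`. -/
noncomputable instance : Group (HolAut E X) where
  mul φ ψ := Diffeomorph.trans ψ φ
  one := Diffeomorph.refl 𝓘(ℂ, E) X ω
  inv φ := Diffeomorph.symm φ
  mul_assoc _ _ _ := rfl
  one_mul _ := rfl
  mul_one _ := rfl
  inv_mul_cancel φ := ext fun x => φ.toEquiv.symm_apply_apply x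

@[simp] theorem one_apply (x : X) : (1 : HolAut E X) x = x := rfl

@[simp] theorem mul_apply (φ ψ : HolAut E X) (x : X) : (φ * ψ) x = φ (ψ x) := rfl

theorem continuous_coe (φ : HolAut E X) : Continuous (φ : X → X) :=
  Diffeomorph.continuous φ

/-- An automorphism as an element of the space `C(X, X)` of continuous self-maps, which Mathlib
equips with the compact-open topology. -/
def toContinuousMap (φ : HolAut E X) : C(X, X) := ⟨φ, continuous_coe φ⟩

/-- The topology of `Aut(X)`: the one induced by the embedding `φ ↦ (φ, φ⁻¹)` into the product of
two copies of the space of self-maps of `X` with the compact-open topology. -/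
noncomputable instance : TopologicalSpace (HolAut E X) :=
  TopologicalSpace.induced
    (fun φ : HolAut E X => (toContinuousMap φ, toContinuousMap φ⁻¹)) inferInstance

end HolAut

/-- A group `G` with a topology is a (finite-dimensional) real Lie group: it carries an atlas,
for its given topology, of a smooth real manifold of some finite dimension `k` for which
multiplication and inversion are smooth. -/
def IsRealLieGroup (G : Type*) [Group G] [TopologicalSpace G] : Prop :=
  ∃ (k : ℕ) (_ : ChartedSpace (EuclideanSpace ℝ (Fin k)) G),
    LieGroup 𝓘(ℝ, EuclideanSpace ℝ (Fin k)) ∞ G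

/-!
The set `D` can be taken finite. Suppose `P` is a finite set whose pointwise stabilizer in `Aut(X)`
is countable. For a finite set `D₀`, the automorphisms that map `P` into `D₀` are then countably
many, being finitely many cosets of that stabilizer. By the Baire category theorem and the identity
theorem, a generic point `y` of a given component is moved outside `D₀ ∪ {y}` by each of these
automorphisms that is not the identity on that component. Adding one generic point for each of `r`
components, one obtains a finite set `D` such that an automorphism with `φ(P) ⊆ D₀` and `φ(D) ⊆ D`
is the identity on these components (`HolAut.exists_finset_superset_card_le`).

It remains to remove the condition `φ(P) ⊆ D₀`. Take `D₀` to be the union of `r + 1` pairwise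
disjoint sets `P` as above. An automorphism that preserves `D` is injective, so at most `r` points
are sent to the `r` added points, and one of the `r + 1` sets is mapped into `D₀`
(`Finset.exists_mapsTo_of_card_sdiff_lt`).

The Lie group hypothesis enters through local compactness and the absence of small subgroups
(`LieGroup.exists_nhds_one_forall_pow_mem_imp_eq_one`). The latter shows that an automorphism that
is the identity on finitely many suitable components is trivial
(`HolAut.exists_finset_forall_eventuallyEq_id_imp_eq_one`), and both together give the finite sets
with discrete, hence countable, stabilizer (`HolAut.exists_finset_countable_pointwiseStabilizer`).
-/

open Set Filter Topology

/-! ### Absence of small subgroups in Lie groups -/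

/-- A Lie group has no small subgroups: some neighbourhood of `1` contains all powers of no element
other than `1`. In a chart at `1` the squaring map has derivative `2`, so it multiplies the distance
to the origin by at least `3 / 2` near `1`, and iterated squares leave the neighbourhood. -/
theorem LieGroup.exists_nhds_one_forall_pow_mem_imp_eq_one
    {F : Type*} [NormedAddCommGroup F] [NormedSpace ℝ F]
    {G : Type*} [Group G] [TopologicalSpace G] [ChartedSpace F G] [LieGroup 𝓘(ℝ, F) ∞ G] :
    ∃ U ∈ 𝓝 (1 : G), ∀ g : G, (∀ n : ℕ, g ^ n ∈ U) → g = 1 := by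
  set c := extChartAt 𝓘(ℝ, F) (1 : G) with hc
  set e : F := c 1 with he
  have he_symm : c.symm e = 1 := extChartAt_to_inv (I := 𝓘(ℝ, F)) (1 : G)
  have htgt : c.target ∈ 𝓝 e := extChartAt_target_mem_nhds (I := 𝓘(ℝ, F)) (1 : G)
  -- the multiplication read in the chart; its derivative at `(e, e)` is addition
  let m : F × F → F := fun p => c (c.symm p.1 * c.symm p.2)
  have hsymm : ContMDiffAt 𝓘(ℝ, F) 𝓘(ℝ, F) ∞ c.symm e :=
    (contMDiffOn_extChartAt_symm (1 : G)).contMDiffAt htgt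
  have hm_diff : DifferentiableAt ℝ m (e, e) := by
    have hprod : ContMDiffAt 𝓘(ℝ, F × F) 𝓘(ℝ, F) ∞
        (fun p : F × F => c.symm p.1 * c.symm p.2) (e, e) :=
      (ContMDiffAt.comp (e, e) (g := c.symm) hsymm contDiff_fst.contMDiff.contMDiffAt).mul
        (ContMDiffAt.comp (e, e) (g := c.symm) hsymm contDiff_snd.contMDiff.contMDiffAt)
    have hc1 : ContMDiffAt 𝓘(ℝ, F) 𝓘(ℝ, F) ∞ c (c.symm e * c.symm e) := by
      rw [he_symm, mul_one]
      exact contMDiffAt_extChartAt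
    have := ContMDiffAt.comp (e, e) (g := c) hc1 hprod
    exact this.contDiffAt.differentiableAt (by simp)
  obtain ⟨L, hL⟩ := hm_diff
  have hid : ∀ᶠ x in 𝓝 e, c (c.symm x) = x :=
    eventually_of_mem htgt fun x hx => c.right_inv hx
  have hL1 : ∀ v : F, L (v, 0) = v := by
    have h1 : HasFDerivAt (fun x : F => m (x, e)) (L.comp (.inl ℝ F F)) e :=
      HasFDerivAt.comp e (f := fun x : F => (x, e)) hL (hasFDerivAt_prodMk_left e e)
    have h2 : HasFDerivAt (fun x : F => m (x, e)) (.id ℝ F) e :=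
      (hasFDerivAt_id e).congr_of_eventuallyEq <| hid.mono fun x hx => by
        simp [m, he_symm, hx]
    intro v
    simpa using congrArg (fun T : F →L[ℝ] F => T v) (h1.unique h2)
  have hL2 : ∀ v : F, L (0, v) = v := by
    have h1 : HasFDerivAt (fun x : F => m (e, x)) (L.comp (.inr ℝ F F)) e :=
      HasFDerivAt.comp e (f := fun x : F => (e, x)) hL (hasFDerivAt_prodMk_right e e)
    have h2 : HasFDerivAt (fun x : F => m (e, x)) (.id ℝ F) e :=
      (hasFDerivAt_id e).congr_of_eventuallyEq <| hid.mono fun x hx => by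
        simp [m, he_symm, hx]
    intro v
    simpa using congrArg (fun T : F →L[ℝ] F => T v) (h1.unique h2)
  have hL3 : ∀ v : F, L (v, v) = v + v := fun v => by
    conv_rhs => rw [← hL1 v]
    nth_rw 3 [← hL2 v]
    rw [hL1, ← map_add]; simp
  have hmee : m (e, e) = e := by
    change c (c.symm e * c.symm e) = e
    rw [he_symm, mul_one]
  have hdiag : HasFDerivAt (fun x : F => m (x, x))
      (L.comp ((ContinuousLinearMap.id ℝ F).prod (.id ℝ F))) e :=
    HasFDerivAt.comp e (f := fun x : F => (x, x)) hL ((hasFDerivAt_id e).prodMk (hasFDerivAt_id e))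
  have hgrow : ∀ᶠ x in 𝓝 e, (3 / 2 : ℝ) * ‖x - e‖ ≤ ‖m (x, x) - e‖ := by
    filter_upwards [hdiag.isLittleO.bound (c := 1 / 2) (by norm_num)] with x hx
    simp only [hmee, ContinuousLinearMap.comp_apply, ContinuousLinearMap.prod_apply,
      ContinuousLinearMap.id_apply, hL3] at hx
    have h3 : ‖(x - e) + (x - e)‖ = 2 * ‖x - e‖ := by
      rw [← two_smul ℝ, norm_smul]; simp
    have h4 := norm_sub_norm_le ((x - e) + (x - e)) (m (x, x) - e)
    rw [norm_sub_rev (x - e + (x - e))] at h4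
    linarith
  obtain ⟨ε, hε, hball⟩ := Metric.eventually_nhds_iff_ball.1 hgrow
  refine ⟨c.source ∩ c ⁻¹' Metric.ball e ε, inter_mem (extChartAt_source_mem_nhds (1 : G))
    ((continuousAt_extChartAt (1 : G)).preimage_mem_nhds (Metric.ball_mem_nhds _ hε)),
    fun g hg => ?_⟩
  have hiter : ∀ n : ℕ, (3 / 2 : ℝ) ^ n * ‖c g - e‖ ≤ ‖c (g ^ 2 ^ n) - e‖ := by
    intro n
    induction n with
    | zero => simp
    | succ n ih =>
      have h := hball _ (hg (2 ^ n)).2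
      simp only [m, c.left_inv (hg (2 ^ n)).1] at h
      rw [← pow_add, ← two_mul, ← pow_succ'] at h
      calc _ = (3 / 2 : ℝ) * ((3 / 2) ^ n * ‖c g - e‖) := by ring
        _ ≤ (3 / 2 : ℝ) * ‖c (g ^ 2 ^ n) - e‖ := by gcongr
        _ ≤ _ := h
  have hzero : ‖c g - e‖ = 0 := by
    by_contra hne
    have hpos : 0 < ‖c g - e‖ := lt_of_le_of_ne (norm_nonneg _) (Ne.symm hne)
    obtain ⟨n, hn⟩ := pow_unbounded_of_one_lt (ε / ‖c g - e‖) (by norm_num : (1 : ℝ) < 3 / 2)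
    rw [div_lt_iff₀ hpos] at hn
    have := (hg (2 ^ n)).2
    rw [mem_preimage, mem_ball_iff_norm] at this
    linarith [hiter n]
  refine c.injOn (by simpa using (hg 1).1) (mem_extChartAt_source (1 : G)) ?_
  exact sub_eq_zero.1 (norm_eq_zero.1 hzero)

/-! ### Neighbourhoods in the compact-open topology -/

/-- Membership in a compact-open neighbourhood of `f` is forced by agreement with `f` on a
suitable compact set. -/
theorem ContinuousMap.exists_isCompact_forall_eqOn_imp_mem {X Y : Type*} [TopologicalSpace X]
    [TopologicalSpace Y] {f : C(X, Y)} {u : Set C(X, Y)} (hu : u ∈ 𝓝 f) :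
    ∃ K : Set X, IsCompact K ∧ ∀ g : C(X, Y), EqOn g f K → g ∈ u := by
  obtain ⟨v, hvu, hv, hfv⟩ := mem_nhds_iff.1 hu
  suffices h : ∃ K : Set X, IsCompact K ∧ ∀ g : C(X, Y), EqOn g f K → g ∈ v by
    obtain ⟨K, hK, h⟩ := h
    exact ⟨K, hK, fun g hg => hvu (h g hg)⟩
  have hv' : TopologicalSpace.GenerateOpen _ v := hv
  clear hu hv hvu
  induction hv' with
  | basic s hs =>
    obtain ⟨K, hK, U, -, rfl⟩ := hs
    exact ⟨K, hK, fun g hg x hx => by rw [hg hx]; exact hfv hx⟩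
  | univ => exact ⟨∅, isCompact_empty, fun _ _ => trivial⟩
  | inter s t _ _ ihs iht =>
    obtain ⟨K, hK, h⟩ := ihs hfv.1
    obtain ⟨K', hK', h'⟩ := iht hfv.2
    exact ⟨K ∪ K', hK.union hK', fun g hg =>
      ⟨h g (hg.mono subset_union_left), h' g (hg.mono subset_union_right)⟩⟩
  | sUnion S _ ih =>
    obtain ⟨s, hs, hfs⟩ := hfv
    obtain ⟨K, hK, h⟩ := ih s hs hfs
    exact ⟨K, hK, fun g hg => ⟨s, hs, h g hg⟩⟩

/-! ### The identity theorem for self-maps of a complex manifold -/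

section Identity

variable {E : Type*} [NormedAddCommGroup E] [NormedSpace ℂ E]
  {X : Type*} [TopologicalSpace X] [ChartedSpace E X] [T2Space X] [IsManifold 𝓘(ℂ, E) ω X]

/-- The closedness half of the identity theorem; openness is automatic. At a limit point `x` the
map fixes `x`, so it can be read in one chart on both sides, on a ball where it is analytic. -/
theorem ContMDiff.isClosed_setOfPred_eventuallyEq_id {f : X → X}
    (hf : ContMDiff 𝓘(ℂ, E) 𝓘(ℂ, E) ω f) : IsClosed {x | f =ᶠ[𝓝 x] id} := by
  refine isClosed_of_closure_subset fun x hx => ?_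
  have hfx : f x = x := by
    have hcl : closure {x | f =ᶠ[𝓝 x] id} ⊆ {x | f x = x} :=
      closure_minimal (fun y hy => hy.eq_of_nhds) (isClosed_eq hf.continuous continuous_id)
    exact hcl hx
  set c := extChartAt 𝓘(ℂ, E) x with hc
  have htgt : IsOpen c.target := isOpen_extChartAt_target x
  have hsrc : IsOpen c.source := isOpen_extChartAt_source x
  have hcx : c x ∈ c.target := mem_extChartAt_target x
  have hsx : c.symm (c x) = x := extChartAt_to_inv x
  have hcont : ∀ y ∈ c.target, ContinuousAt c.symm y := fun y hy =>
    (continuousOn_extChartAt_symm x).continuousAt (htgt.mem_nhds hy)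
  have hev : ∀ᶠ y in 𝓝 (c x), y ∈ c.target ∧ f (c.symm y) ∈ c.source := by
    refine (htgt.eventually_mem hcx).and ?_
    refine (hf.continuous.continuousAt.comp (hcont _ hcx)).eventually_mem (hsrc.mem_nhds ?_)
    simp only [Function.comp_apply, hsx, hfx]
    exact mem_extChartAt_source x
  obtain ⟨ε, hε, hball⟩ := Metric.eventually_nhds_iff_ball.1 hev
  have hana : AnalyticOnNhd ℂ (fun y => c (f (c.symm y))) (Metric.ball (c x) ε) := by
    intro y hy
    have h1 : ContMDiffAt 𝓘(ℂ, E) 𝓘(ℂ, E) ω c.symm y :=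
      (contMDiffOn_extChartAt_symm x).contMDiffAt (htgt.mem_nhds (hball y hy).1)
    have h2 : ContMDiffAt 𝓘(ℂ, E) 𝓘(ℂ, E) ω c (f (c.symm y)) :=
      contMDiffAt_extChartAt' (by simpa [hc] using (hball y hy).2)
    exact (h2.comp y (hf.contMDiffAt.comp y h1)).contDiffAt.analyticAt
  have hB : c.source ∩ c ⁻¹' Metric.ball (c x) ε ∈ 𝓝 x :=
    inter_mem (extChartAt_source_mem_nhds x)
      ((continuousAt_extChartAt x).preimage_mem_nhds (Metric.ball_mem_nhds _ hε))
  obtain ⟨s, ⟨hs1, hs2⟩, hs3⟩ := mem_closure_iff_nhds.1 hx _ hB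
  have hseq : (fun y => c (f (c.symm y))) =ᶠ[𝓝 (c s)] fun y => y := by
    have h1 : Tendsto c.symm (𝓝 (c s)) (𝓝 s) := by
      have := hcont (c s) (c.map_source hs1)
      rwa [ContinuousAt, c.left_inv hs1] at this
    filter_upwards [h1.eventually hs3, htgt.mem_nhds (c.map_source hs1)] with y hy hy'
    rw [hy, id, c.right_inv hy']
  have heq := hana.eqOn_of_preconnected_of_eventuallyEq analyticOnNhd_id
    (convex_ball (c x) ε).isPreconnected hs2 hseq
  filter_upwards [hB] with y hy
  have h1 := heq hy.2
  have h2 := (hball _ hy.2).2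
  simp only [c.left_inv hy.1] at h1 h2
  exact c.injOn h2 hy.1 h1

theorem ContMDiff.eventuallyEq_id_of_mem_connectedComponent {f : X → X}
    (hf : ContMDiff 𝓘(ℂ, E) 𝓘(ℂ, E) ω f) {x y : X} (hx : f =ᶠ[𝓝 x] id)
    (hy : y ∈ connectedComponent x) : f =ᶠ[𝓝 y] id :=
  IsClopen.connectedComponent_subset
    ⟨hf.isClosed_setOfPred_eventuallyEq_id, isOpen_setOfPred_eventually_nhds⟩ hx hy

end Identity

/-! ### Stabilizers and generic points -/

namespace HolAut

variable {E : Type*} [NormedAddCommGroup E] [NormedSpace ℂ E]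
  {X : Type*} [TopologicalSpace X] [ChartedSpace E X]

protected theorem injective (φ : HolAut E X) : Function.Injective φ := φ.toEquiv.injective

theorem contMDiff_coe (φ : HolAut E X) : ContMDiff 𝓘(ℂ, E) 𝓘(ℂ, E) ω (φ : X → X) :=
  Diffeomorph.contMDiff φ

theorem inv_apply_self (φ : HolAut E X) (x : X) : φ⁻¹ (φ x) = x := φ.toEquiv.symm_apply_apply x

theorem continuous_toContinuousMap :
    Continuous (toContinuousMap : HolAut E X → C(X, X)) :=
  continuous_fst.comp
    (continuous_induced_dom (f := fun φ : HolAut E X => (toContinuousMap φ, toContinuousMap φ⁻¹)))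

theorem continuous_eval_const (x : X) : Continuous fun φ : HolAut E X => φ x :=
  (ContinuousEvalConst.continuous_eval_const (F := C(X, X)) x).comp continuous_toContinuousMap

theorem secondCountableTopology [LocallyCompactSpace X] [SecondCountableTopology X] :
    SecondCountableTopology (HolAut E X) :=
  TopologicalSpace.secondCountableTopology_induced _ _ _

theorem exists_isCompact_forall_eqOn_id_imp_mem {U : Set (HolAut E X)} (hU : U ∈ 𝓝 1) :
    ∃ K : Set X, IsCompact K ∧ ∀ φ : HolAut E X, EqOn φ id K → φ ∈ U := by
  rw [nhds_induced, mem_comap] at hU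
  obtain ⟨t, ht, htU⟩ := hU
  obtain ⟨u, hu, v, hv, huv⟩ := mem_nhds_prod_iff.1 ht
  obtain ⟨K, hK, hKu⟩ := ContinuousMap.exists_isCompact_forall_eqOn_imp_mem hu
  obtain ⟨K', hK', hKv⟩ := ContinuousMap.exists_isCompact_forall_eqOn_imp_mem hv
  refine ⟨K ∪ K', hK.union hK', fun φ hφ => htU (huv ⟨hKu _ fun x hx => hφ (Or.inl hx),
    hKv _ fun x hx => ?_⟩)⟩
  have hx' : φ x = x := hφ (Or.inr hx)
  change φ⁻¹ x = x
  conv_lhs => rw [← hx', inv_apply_self]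

/-- If a neighbourhood of `1` contains no nontrivial cyclic subgroup, finitely many points detect
whether an automorphism is trivial through its germs there. One point is taken in each of the
components meeting a compact set that controls the neighbourhood; there may be infinitely many
other components. -/
theorem exists_finset_forall_eventuallyEq_id_imp_eq_one [LocallyConnectedSpace X] [T2Space X]
    [IsManifold 𝓘(ℂ, E) ω X] {U : Set (HolAut E X)} (hU : U ∈ 𝓝 1)
    (hsmall : ∀ φ : HolAut E X, (∀ n : ℕ, φ ^ n ∈ U) → φ = 1) :
    ∃ Q : Finset X, ∀ φ : HolAut E X, (∀ q ∈ Q, φ =ᶠ[𝓝 q] id) → φ = 1 := by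
  obtain ⟨K, hK, hKU⟩ := exists_isCompact_forall_eqOn_id_imp_mem hU
  obtain ⟨Q, -, hQ⟩ := hK.elim_nhds_subcover connectedComponent
    fun x _ => isOpen_connectedComponent.mem_nhds mem_connectedComponent
  refine ⟨Q, fun φ hφ => hsmall φ fun n => hKU _ fun x hx => ?_⟩
  obtain ⟨q, hq, hxq⟩ := mem_iUnion₂.1 (hQ hx)
  have hfix : φ x = x :=
    (φ.contMDiff_coe.eventuallyEq_id_of_mem_connectedComponent (hφ q hq) hxq).eq_of_nhds
  change (φ ^ n) x = x
  induction n with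
  | zero => simp
  | succ n ih => rw [pow_succ, mul_apply, hfix, ih]

variable (E) in
/-- The subgroup of automorphisms of `X` fixing every point of `P`. -/
def pointwiseStabilizer (P : Set X) : Subgroup (HolAut E X) where
  carrier := {φ | ∀ p ∈ P, φ p = p}
  mul_mem' {φ ψ} hφ hψ p hp := by rw [mul_apply, hψ p hp, hφ p hp]
  one_mem' _ _ := rfl
  inv_mem' {φ} hφ p hp := by conv_lhs => rw [← hφ p hp, inv_apply_self]

theorem mem_pointwiseStabilizer {P : Set X} {φ : HolAut E X} :
    φ ∈ pointwiseStabilizer E P ↔ ∀ p ∈ P, φ p = p := Iff.rfl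

/-- In the absence of small subgroups, the pointwise stabilizer of a suitable finite set is
discrete, hence countable, and the set can be chosen away from any given finite set. -/
theorem exists_finset_countable_pointwiseStabilizer [T2Space X] [∀ x : X, (𝓝[≠] x).NeBot]
    [IsTopologicalGroup (HolAut E X)] [LocallyCompactSpace (HolAut E X)]
    [SecondCountableTopology (HolAut E X)] {U : Set (HolAut E X)} (hU : U ∈ 𝓝 1)
    (hsmall : ∀ φ : HolAut E X, (∀ n : ℕ, φ ^ n ∈ U) → φ = 1) (F : Finset X) :
    ∃ P : Finset X, Disjoint P F ∧
      (pointwiseStabilizer E (P : Set X) : Set (HolAut E X)).Countable := by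
  classical
  obtain ⟨C, hC, hCU, hCc⟩ := local_compact_nhds hU
  obtain ⟨V, hVo, hV1, hVC⟩ := exists_open_nhds_one_mul_subset hC
  have hmove : ∀ φ ∈ C \ V, ∃ x, x ∉ F ∧ φ x ≠ x := by
    intro φ hφ
    by_contra! h
    have hdense : Dense ((F : Set X)ᶜ) := by
      simpa [compl_eq_univ_sdiff] using dense_univ.sdiff_finset F
    have : (φ : X → X) = id :=
      Continuous.ext_on hdense φ.continuous_coe continuous_id fun x hx => h x hx
    exact hφ.2 (by rw [show φ = 1 from ext fun x => congrFun this x]; exact hV1)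
  -- Finitely many of the moved points suffice for the compact set `C \ V`.
  obtain ⟨T, hTcov⟩ := (hCc.diff hVo).elim_finite_subcover
    (fun x : {x // x ∉ F} => {ψ : HolAut E X | ψ x ≠ x})
    (fun x => isOpen_ne_fun (continuous_eval_const x.1) continuous_const)
    fun φ hφ => by
      obtain ⟨x, hxF, hx⟩ := hmove φ hφ
      exact mem_iUnion.2 ⟨⟨x, hxF⟩, hx⟩
  refine ⟨T.image (↑), ?_, ?_⟩
  · rw [Finset.disjoint_left]
    intro y hy
    obtain ⟨x, -, rfl⟩ := Finset.mem_image.1 hy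
    exact x.2
  set H := pointwiseStabilizer E ((T.image (↑) : Finset X) : Set X)
  -- The stabilizer meets `C` only in `V`, and `V * V ⊆ C`, so its elements in `C` have all their
  -- powers in `C`.
  have hHV : ∀ φ ∈ H, φ ∈ C → φ ∈ V := by
    intro φ hφ hφC
    by_contra hφV
    obtain ⟨x, hx, h⟩ := mem_iUnion₂.1 (hTcov ⟨hφC, hφV⟩)
    exact h (hφ _ (Finset.mem_coe.2 (Finset.mem_image_of_mem _ hx)))
  have hHC : ∀ φ ∈ H, φ ∈ C → φ = 1 := by
    intro φ hφ hφC
    refine hsmall φ fun n => hCU ?_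
    induction n with
    | zero => rw [pow_zero]; exact mem_of_mem_nhds hC
    | succ n ih =>
      rw [pow_succ]
      exact hVC (mul_mem_mul (hHV _ (H.pow_mem hφ n) ih) (hHV _ hφ hφC))
  have : DiscreteTopology H := by
    refine discreteTopology_of_isOpen_singleton_one (isOpen_iff_mem_nhds.2 fun φ hφ => ?_)
    rw [mem_singleton_iff.1 hφ]
    filter_upwards [continuous_subtype_val.continuousAt.preimage_mem_nhds (x := (1 : H)) hC]
      with ψ hψ
    exact Subtype.ext (hHC ψ ψ.2 hψ)
  have : Countable H := TopologicalSpace.separableSpace_iff_countable.1 inferInstance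
  exact this.to_set

/-- For each of the finitely many maps `P → D`, the automorphisms restricting to it form the empty
set or a coset of the pointwise stabilizer. -/
theorem countable_setOf_mapsTo {P : Set X} (hP : P.Finite)
    (hstab : (pointwiseStabilizer E P : Set (HolAut E X)).Countable) {D : Set X} (hD : D.Finite) :
    {φ : HolAut E X | MapsTo φ P D}.Countable := by
  have := hP.to_subtype
  have := hD.to_subtype
  have hcover : {φ : HolAut E X | MapsTo φ P D} ⊆
      ⋃ f : P → D, {φ : HolAut E X | ∀ p : P, φ p = f p} := fun φ hφ =>
    mem_iUnion.2 ⟨fun p => ⟨φ p, hφ p.2⟩, fun _ => rfl⟩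
  refine (countable_iUnion fun f : P → D => ?_).mono hcover
  rcases eq_empty_or_nonempty {φ : HolAut E X | ∀ p : P, φ p = f p} with h | ⟨φ₀, hφ₀⟩
  · rw [h]; exact countable_empty
  · refine (hstab.image (φ₀ * ·)).mono fun φ hφ => (mem_image _ _ _).2
      ⟨φ₀⁻¹ * φ, mem_pointwiseStabilizer.2 fun p hp => ?_, ?_⟩
    · rw [mul_apply, hφ ⟨p, hp⟩, ← hφ₀ ⟨p, hp⟩, inv_apply_self]
    · exact mul_inv_cancel_left φ₀ φ

/-- Genericity: relative to a countable set `A` of automorphisms, a finite set `D` can be enlarged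
by at most one point for each `q ∈ Q` so that an element of `A` preserving the larger set has to be
the identity near each `q`. The added points exist by the Baire category theorem. -/
theorem exists_finset_superset_card_le [LocallyConnectedSpace X] [T2Space X] [BaireSpace X]
    [∀ x : X, (𝓝[≠] x).NeBot] [IsManifold 𝓘(ℂ, E) ω X] [DecidableEq X]
    {A : Set (HolAut E X)} (hA : A.Countable) (D Q : Finset X) :
    ∃ D' : Finset X, D ⊆ D' ∧ (D' \ D).card ≤ Q.card ∧
      ∀ φ ∈ A, MapsTo φ D' D' → ∀ q ∈ Q, φ =ᶠ[𝓝 q] id := by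
  induction Q using Finset.induction_on with
  | empty => exact ⟨D, subset_rfl, by simp, by simp⟩
  | insert q Q hq ih =>
    obtain ⟨D', hDD', hcard, hD'⟩ := ih
    -- As `y ∉ φ(D')`, an element `φ` of `A` preserving `insert y D'` preserves `D'`; as moreover
    -- `φ y ∉ D'`, it fixes `y`, and the last condition applies.
    obtain ⟨y, hyq, hy⟩ : ∃ y ∈ connectedComponent q, ∀ φ ∈ A,
        (∀ d ∈ D', φ d ≠ y ∧ φ y ≠ d) ∧ (φ y = y → φ =ᶠ[𝓝 q] id) := by
      -- For each `φ ∈ A`, `y` has to avoid the finite set `S φ` and the closed set `B φ`, which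
      -- has empty interior by the identity theorem.
      let S : HolAut E X → Set X := fun φ => φ '' D' ∪ (φ⁻¹ : HolAut E X) '' D'
      let B : HolAut E X → Set X := fun φ =>
        connectedComponent q ∩ {y | φ y = y} ∩ {_y | ¬ φ =ᶠ[𝓝 q] id}
      have hS : ∀ φ : HolAut E X, (S φ).Finite := fun φ =>
        (D'.finite_toSet.image _).union (D'.finite_toSet.image _)
      have hB : ∀ φ : HolAut E X, IsClosed (B φ) := fun φ =>
        (isClosed_connectedComponent.inter (isClosed_eq φ.continuous_coe continuous_id)).inter
          isClosed_const
      have hBdense : ∀ φ : HolAut E X, Dense (B φ)ᶜ := by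
        intro φ
        rw [← interior_eq_empty_iff_dense_compl, eq_empty_iff_forall_notMem]
        intro x hx
        have hxB := interior_subset hx
        refine hxB.2 (φ.contMDiff_coe.eventuallyEq_id_of_mem_connectedComponent
          (x := x) ?_ ?_)
        · filter_upwards [mem_interior_iff_mem_nhds.1 hx] with z hz using hz.1.2
        · rw [← connectedComponent_eq hxB.1.1]
          exact mem_connectedComponent
      have hSdense : ∀ φ : HolAut E X, Dense (S φ)ᶜ := fun φ => by
        simpa [compl_eq_univ_sdiff] using dense_univ.sdiff_finite (hS φ)
      obtain ⟨y, hyq, hy⟩ := (dense_biInter_of_isOpen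
        (fun φ _ => (hS φ).isClosed.isOpen_compl.inter (hB φ).isOpen_compl) hA
        (fun φ _ => (hSdense φ).inter_of_isOpen_left (hBdense φ)
          (hS φ).isClosed.isOpen_compl)).exists_mem_open
          (isOpen_connectedComponent (x := q)) ⟨q, mem_connectedComponent⟩
      refine ⟨y, hy, fun φ hφ => ?_⟩
      have hyφ := mem_iInter₂.1 hyq φ hφ
      refine ⟨fun d hd => ⟨fun h => hyφ.1 (Or.inl ⟨d, hd, h⟩),
        fun h => hyφ.1 (Or.inr ⟨d, hd, ?_⟩)⟩, fun h => ?_⟩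
      · rw [← h, inv_apply_self]
      · by_contra hne
        exact hyφ.2 ⟨⟨hy, h⟩, hne⟩
    refine ⟨insert y D', hDD'.trans (Finset.subset_insert _ _), ?_, fun φ hφ hmaps => ?_⟩
    · rw [Finset.card_insert_of_notMem hq]
      calc (insert y D' \ D).card ≤ (insert y (D' \ D)).card :=
            Finset.card_le_card fun z => by simp; tauto
        _ ≤ (D' \ D).card + 1 := Finset.card_insert_le _ _
        _ ≤ Q.card + 1 := by gcongr
    · have hmaps' : MapsTo φ D' D' := fun d hd => by
        have h : φ d ∈ insert y D' := hmaps (Finset.mem_insert_of_mem hd)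
        exact (Finset.mem_insert.1 h).resolve_left ((hy φ hφ).1 d hd).1
      have hfix : φ y = y := by
        have h : φ y ∈ insert y D' := hmaps (Finset.mem_insert_self y D')
        exact (Finset.mem_insert.1 h).resolve_right fun h' => ((hy φ hφ).1 _ h').2 rfl
      intro p hp
      rcases Finset.mem_insert.1 hp with rfl | hp
      · exact (hy φ hφ).2 hfix
      · exact hD' φ hφ hmaps' p hp

theorem exists_pairwise_disjoint_countable_pointwiseStabilizer
    (h : ∀ F : Finset X, ∃ P : Finset X, Disjoint P F ∧
      (pointwiseStabilizer E (P : Set X) : Set (HolAut E X)).Countable) (n : ℕ) :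
    ∃ P : Fin n → Finset X, Pairwise (Function.onFun Disjoint P) ∧
      ∀ i, (pointwiseStabilizer E (P i : Set X) : Set (HolAut E X)).Countable := by
  classical
  induction n with
  | zero => exact ⟨fun _ => ∅, fun i => i.elim0, fun i => i.elim0⟩
  | succ n ih =>
    obtain ⟨P, hdisj, hP⟩ := ih
    obtain ⟨P₀, hP₀, hP₀c⟩ := h (Finset.univ.biUnion P)
    rw [Finset.disjoint_biUnion_right] at hP₀
    refine ⟨Fin.cons P₀ P, fun i j => ?_, fun i => ?_⟩
    · refine Fin.cases ?_ (fun i => ?_) i <;> refine Fin.cases ?_ (fun j => ?_) j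
      · exact fun h => absurd rfl h
      · exact fun _ => hP₀ j (Finset.mem_univ _)
      · exact fun _ => (hP₀ i (Finset.mem_univ _)).symm
      · exact fun hij => hdisj fun h => hij (congrArg _ h)
    · refine Fin.cases ?_ (fun i => ?_) i
      · exact hP₀c
      · exact hP i

end HolAut

/-! ### Construction of the finite set -/

/-- Pigeonhole: an injective self-map of `D'` sends fewer than `n` points to `D' \ D`, hence maps
one of `n` pairwise disjoint subsets of `D'` into `D`. -/
theorem Finset.exists_mapsTo_of_card_sdiff_lt {X : Type*} [DecidableEq X] {n : ℕ}
    {P : Fin n → Finset X} (hP : Pairwise (Function.onFun Disjoint P)) {D D' : Finset X} (hPD : ∀ i, P i ⊆ D')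
    (hcard : (D' \ D).card < n) {f : X → X} (hf : Function.Injective f)
    (hmaps : MapsTo f D' D') : ∃ i, MapsTo f (P i) D := by
  by_contra! h
  have h' : ∀ i, ∃ p ∈ P i, f p ∉ D := fun i => by
    simpa [MapsTo] using h i
  choose p hp hpD using h'
  have hinj : Function.Injective p := fun i j hij => by
    by_contra hne
    exact Finset.disjoint_left.1 (hP hne) (hp i) (hij ▸ hp j)
  have := Finset.card_le_card_of_injOn (s := Finset.univ) (t := D' \ D) (fun i => f (p i))
    (fun i _ => Finset.mem_coe.2 (Finset.mem_sdiff.2 ⟨hmaps (hPD i (hp i)), hpD i⟩))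
    (hf.comp hinj).injOn
  rw [Finset.card_univ, Fintype.card_fin] at this
  omega

theorem ChartedSpace.nhdsNE_neBot (E : Type*) [TopologicalSpace E] [∀ v : E, (𝓝[≠] v).NeBot]
    {X : Type*} [TopologicalSpace X] [ChartedSpace E X] (x : X) : (𝓝[≠] x).NeBot := by
  refine mem_closure_iff_nhdsWithin_neBot.1
    (dense_compl_singleton_iff_not_open.2 (fun hx => ?_) x)
  have := (chartAt E x).isOpen_image_of_subset_source hx (by simp)
  rw [image_singleton] at this
  exact not_isOpen_singleton _ this

theorem proposition5 {E : Type*} [NormedAddCommGroup E] [NormedSpace ℂ E]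
    [FiniteDimensional ℂ E] (hdim : 0 < Module.finrank ℂ E)
    {X : Type*} [TopologicalSpace X] [T2Space X] [SecondCountableTopology X]
    [ChartedSpace E X] [IsManifold 𝓘(ℂ, E) ω X]
    (hAut : IsRealLieGroup (HolAut E X)) :
    ∃ D : Set X, IsClosed D ∧ IsDiscrete D ∧
      ∀ φ : HolAut E X, (φ : X → X) '' D ⊆ D → φ = 1 := by
  classical
  have : ProperSpace E := FiniteDimensional.proper ℂ E
  have : Nontrivial E := Module.nontrivial_of_finrank_pos hdim
  have : ∀ v : E, (𝓝[≠] v).NeBot := fun v => Module.punctured_nhds_neBot ℂ E v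
  have : ∀ x : X, (𝓝[≠] x).NeBot := ChartedSpace.nhdsNE_neBot E
  have : LocallyCompactSpace X := ChartedSpace.locallyCompactSpace E X
  have : LocallyConnectedSpace X := ChartedSpace.locallyConnectedSpace E X
  have : SecondCountableTopology (HolAut E X) := HolAut.secondCountableTopology
  obtain ⟨k, _, _⟩ := hAut
  have : IsTopologicalGroup (HolAut E X) :=
    topologicalGroup_of_lieGroup 𝓘(ℝ, EuclideanSpace ℝ (Fin k)) ∞
  have : LocallyCompactSpace (HolAut E X) :=
    ChartedSpace.locallyCompactSpace (EuclideanSpace ℝ (Fin k)) (HolAut E X)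
  obtain ⟨U, hU, hsmall⟩ := LieGroup.exists_nhds_one_forall_pow_mem_imp_eq_one
    (F := EuclideanSpace ℝ (Fin k)) (G := HolAut E X)
  obtain ⟨Q, hQ⟩ := HolAut.exists_finset_forall_eventuallyEq_id_imp_eq_one hU hsmall
  -- One more set than there are points to be added, as the pigeonhole principle requires.
  obtain ⟨P, hdisj, hP⟩ := HolAut.exists_pairwise_disjoint_countable_pointwiseStabilizer
    (HolAut.exists_finset_countable_pointwiseStabilizer hU hsmall) (Q.card + 1)
  let D := Finset.univ.biUnion P
  have hA : (⋃ i, {φ : HolAut E X | MapsTo φ (P i) D}).Countable :=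
    countable_iUnion fun i =>
      HolAut.countable_setOf_mapsTo (P i).finite_toSet (hP i) D.finite_toSet
  obtain ⟨D', hDD', hcard, hD'⟩ := HolAut.exists_finset_superset_card_le hA D Q
  refine ⟨D', D'.finite_toSet.isClosed, D'.finite_toSet.isDiscrete, fun φ hφ => ?_⟩
  have hmaps : MapsTo φ D' D' := mapsTo_iff_image_subset.2 hφ
  obtain ⟨i, hi⟩ := Finset.exists_mapsTo_of_card_sdiff_lt hdisj (D := D)
    (fun i => (Finset.subset_biUnion_of_mem P (Finset.mem_univ i)).trans hDD')
    (Nat.lt_succ_of_le hcard) φ.injective hmaps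
  exact hQ φ (hD' φ (mem_iUnion.2 ⟨i, hi⟩) hmaps)
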